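/- Let $\mathcal G$ be a weighted digraph on the nodes $1,\dots,N$ with weighted adjacency matrix $(a_{ij})$, where $a_{ij}\ge 0$, $a_{ii}=0$, and there is an edge from $i$ to $j$ exactly when $a_{ij}>0$. Let $\mathcal L=\mathrm{diag}\big(\sum_j a_{1j},\dots,\sum_j a_{Nj}\big)-(a_{ij})$ be its Laplacian. Call a node reachable if there is a directed path to it from every other node, and call $\mathcal G$ connected if it has a reachable node. A real square matrix is Hurwitz if all its eigenvalues have negative real part. For each $i$ let $A_i\in\mathbb R^{n_i\times n_i}$ and $B_i\in\mathbb R^{n_i\times m_i}$, and suppose that $(A_i,B_i)$ is stabilizable, i.e. $A_i-B_iK_i$ is Hurwitz for some $K_i$; the $i$th agent is $\dot x_i=A_ix_i+B_iu_i$. Suppose that $\mathcal G$ is connected. Then $\mathcal G$ has a reachable node, and for every reachable node $i_R$ there are $d_1,\dots,d_N>0$ such that the following holds for all $Q_i\ge 0$ $(1\le i\le N)$ for which no eigenvector of $A_i$ with eigenvalue on the imaginary axis is annihilated by $Q_i^{1/2}$ (the choice $Q_i=I$ is allowed). For each $i$ the algebraic Riccati equation $$A_i'X_i+X_iA_i-X_iB_iB_i'X_i+Q_i=0$$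 has a stabilizing solution, i.e. a solution $X_i\ge 0$ such that $A_i-B_iB_i'X_i$ is Hurwitz; and for all such $X_i$, with the gains $F_i=B_i'X_i$, the full-information distributed protocol $$u_i=d_i\,\delta_{\rm K}(i-i_R)\,v_i+d_i\sum_{j=1}^N a_{ij}(v_i-v_j),\qquad v_i=F_{0i}x_0-F_ix_i,$$ where $x_0\in\mathbb R^{n_0}$ is the state of a reference model and $F_{0i}\in\mathbb R^{m_i\times n_0}$ are arbitrary feedforward gains, is stabilizing: the closed loop is $\dot x=(A-B\mathcal M_DF)x+B\mathcal M_Dr$ with $r_i=F_{0i}x_0$, and $A-B\mathcal M_DF$ is Hurwitz. Here $x$ and $r$ are the stacked vectors of the $x_i$ and the $r_i$, $A=\mathrm{diag}(A_1,\dots,A_N)$, $B=\mathrm{diag}(B_1,\dots,B_N)$, $F=\mathrm{diag}(F_1,\dots,F_N)$, and $\mathcal M_D$ is the block matrix whose $(i,j)$ block is the $m_i\times m_j$ identity matrix times the $(i,j)$ entry of $\mathrm{diag}(d_1,\dots,d_N)(\mathcal L+e_{i_R}e_{i_R}')$. If the numbers of inputs $m_i$ differ, the difference $v_i-v_j$ is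 understood with $v_j$ truncated or filled up with zeros to length $m_i$, and the $m_i\times m_j$ identity matrix is the matrix with entry $1$ at the positions $(k,k)$ and $0$ elsewhere. -/

import Mathlib

open scoped Matrix

/-- A weighted digraph on the nodes `Fin N`, given by its weighted adjacency matrix `(a i j)`:
`a i j ≥ 0` is the coupling strength of the edge from `i` to `j`, which is present exactly when
`a i j > 0`; self-edges are not allowed. -/
structure WeightedDigraph (N : ℕ) where
  /-- the weighted adjacency matrix -/
  a : Matrix (Fin N) (Fin N) ℝ
  nonneg : ∀ i j, 0 ≤ a i j
  no_self_edge : ∀ i, a i i = 0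

namespace WeightedDigraph

variable {N : ℕ}

/-- There is an edge starting at `i` and ending at `j`. -/
def Edge (G : WeightedDigraph N) (i j : Fin N) : Prop := 0 < G.a i j

/-- `k` is a reachable node: every node can reach `k` along a directed path. -/
def IsReachable (G : WeightedDigraph N) (k : Fin N) : Prop :=
  ∀ j, Relation.ReflTransGen G.Edge j k

/-- The digraph is connected: some node can be reached from all the others. -/
def Connected (G : WeightedDigraph N) : Prop := ∃ k, G.IsReachable k

/-- The Laplacian matrix: the diagonal matrix of the row sums, minus the adjacency matrix. -/
def laplacian (G : WeightedDigraph N) : Matrix (Fin N) (Fin N) ℝ :=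
  Matrix.diagonal (fun i => ∑ j, G.a i j) - G.a

/-- The `N × N` matrix `D (L + e e')`, with `D = diag(d)` and `e` the unit vector of `iR`. -/
def pinnedLaplacian (G : WeightedDigraph N) (iR : Fin N) (d : Fin N → ℝ) :
    Matrix (Fin N) (Fin N) ℝ :=
  Matrix.diagonal d * (G.laplacian + Matrix.single iR iR 1)

/-- The block form of `D (L + e e')` acting on stacked input vectors: the block `(i, j)`, of size
`m i × m j`, is the `(i, j)` entry of `D (L + e e')` times the (rectangular) identity matrix.
If `m i = q` for all `i`, it is the Kronecker product of `D (L + e e')` with the `q × q` identity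
matrix. -/
def couplingMatrix (G : WeightedDigraph N) (m : Fin N → ℕ) (iR : Fin N) (d : Fin N → ℝ) :
    Matrix (Σ i, Fin (m i)) (Σ i, Fin (m i)) ℝ :=
  Matrix.of fun p q => if p.2.val = q.2.val then G.pinnedLaplacian iR d p.1 q.1 else 0

end WeightedDigraph

/-- A real square matrix is Hurwitz: its complex eigenvalues have negative real part. -/
def IsHurwitz {ι : Type*} [Fintype ι] [DecidableEq ι] (M : Matrix ι ι ℝ) : Prop :=
  ∀ s ∈ spectrum ℂ (M.map (algebraMap ℝ ℂ)), s.re < 0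

/-- `(A, B)` is stabilizable: some state feedback `u = -K x` makes `x' = A x + B u` stable. -/
def IsStabilizable {n m : ℕ} (A : Matrix (Fin n) (Fin n) ℝ) (B : Matrix (Fin n) (Fin m) ℝ) :
    Prop :=
  ∃ K : Matrix (Fin m) (Fin n) ℝ, IsHurwitz (A - B * K)

/-- The pair `(R, A)` is observable at the imaginary eigenvalues of `A`: no eigenvector of `A` for
an eigenvalue on the imaginary axis is annihilated by `R`. -/
def ObservableOnImaginaryAxis {n : ℕ} (R A : Matrix (Fin n) (Fin n) ℝ) : Prop :=
  ∀ (ω : ℝ) (v : Fin n → ℂ),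
    A.map (algebraMap ℝ ℂ) *ᵥ v = (ω * Complex.I) • v →
    R.map (algebraMap ℝ ℂ) *ᵥ v = 0 → v = 0

/-- An admissible state weight for the Riccati equation: `Q ≥ 0`, and the pair of its positive
semidefinite square root `R` and `A` is observable at the imaginary eigenvalues of `A`. -/
def IsAdmissibleWeight {n : ℕ} (A Q : Matrix (Fin n) (Fin n) ℝ) : Prop :=
  Q.PosSemidef ∧ ∃ R : Matrix (Fin n) (Fin n) ℝ,
    R.PosSemidef ∧ R * R = Q ∧ ObservableOnImaginaryAxis R A

/-- `X ≥ 0` is a stabilizing solution of the algebraic Riccati equation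
`A' X + X A - X B B' X + Q = 0`: the gain `B' X` makes `A - B (B' X)` Hurwitz. -/
structure IsStabilizingSolution {n m : ℕ} (A : Matrix (Fin n) (Fin n) ℝ)
    (B : Matrix (Fin n) (Fin m) ℝ) (Q X : Matrix (Fin n) (Fin n) ℝ) : Prop where
  posSemidef : X.PosSemidef
  riccati : Aᵀ * X + X * A - X * B * Bᵀ * X + Q = 0
  hurwitz : IsHurwitz (A - B * (Bᵀ * X))

/-- The vector `v`, truncated or filled up with zeros to length `q`. -/
def zeroPad {p : ℕ} (q : ℕ) (v : Fin p → ℝ) : Fin q → ℝ :=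
  fun k => if h : k.val < p then v ⟨k.val, h⟩ else 0

theorem zeroPad_self {p : ℕ} (v : Fin p → ℝ) : zeroPad p v = v := by
  funext k
  simp [zeroPad]

/-- The full-information control signal `v_i = F_{0i} x_0 - F_i x_i`. -/
def fullInfoSignal {N n₀ : ℕ} {n m : Fin N → ℕ} (F₀ : ∀ i, Matrix (Fin (m i)) (Fin n₀) ℝ)
    (F : ∀ i, Matrix (Fin (m i)) (Fin (n i)) ℝ) (x₀ : Fin n₀ → ℝ) (x : ∀ i, Fin (n i) → ℝ) :
    ∀ i, Fin (m i) → ℝ :=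
  fun i => F₀ i *ᵥ x₀ - F i *ᵥ x i

/-- The distributed protocol
`u_i = d_i δ(i - i_R) v_i + d_i ∑_j a_{ij} (v_i - v_j)`.
For agents with different numbers of inputs, `v_j` is padded to the length of `v_i`; nothing is
changed when the numbers of inputs agree. -/
def fullInfoProtocol {N : ℕ} {m : Fin N → ℕ} (G : WeightedDigraph N) (iR : Fin N)
    (d : Fin N → ℝ) (v : ∀ i, Fin (m i) → ℝ) : ∀ i, Fin (m i) → ℝ :=
  fun i => (d i * (if i = iR then 1 else 0)) • v i
    + d i • ∑ j, G.a i j • (v i - zeroPad (m i) (v j))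

/-- The stacked vector of a family of vectors. -/
def stack {N : ℕ} {n : Fin N → ℕ} (x : ∀ i, Fin (n i) → ℝ) : (Σ i, Fin (n i)) → ℝ :=
  fun p => x p.1 p.2

/-- The system matrix `A - B M_D F` of the closed loop, with `A`, `B`, `F` block diagonal. -/
def closedLoopMatrix {N : ℕ} {n m : Fin N → ℕ} (G : WeightedDigraph N) (iR : Fin N)
    (d : Fin N → ℝ) (A : ∀ i, Matrix (Fin (n i)) (Fin (n i)) ℝ)
    (B : ∀ i, Matrix (Fin (n i)) (Fin (m i)) ℝ) (F : ∀ i, Matrix (Fin (m i)) (Fin (n i)) ℝ) :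
    Matrix (Σ i, Fin (n i)) (Σ i, Fin (n i)) ℝ :=
  Matrix.blockDiagonal' A
    - Matrix.blockDiagonal' B * G.couplingMatrix m iR d * Matrix.blockDiagonal' F

/-! The proof combines diagonal stability of the graph matrix with a Lyapunov function that is only
semidefinite.

The matrix `H = L + e e'` is a nonsingular M-matrix because the pinned node is reachable, so `y' H =
1'` for some `y > 0`. With `d = 2y` this gives `z' D H z ≥ z' z`
(`exists_pos_pinnedLaplacian_coercive`). This choice depends only on the graph and the pinned node,
so `d` can be fixed before the weights `Q_i`.

Put `V = ∑ x_i' X_i x_i`. By the Riccati equations the uncoupled drift raises `V` at rate at most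
`|F x|²`, while the coupling lowers it at rate at least `2 |F x|²`. Since `V` may be degenerate, an
invariance argument replaces definiteness: on the invariant plane of an eigenvalue with nonnegative
real part the dissipation vanishes, so `F x = 0`, and there the closed loop agrees with `diag(A_i -
B_i F_i)`, which is Hurwitz (`isHurwitz_closedLoopMatrix`).

Stabilizing Riccati solutions come from policy iteration (`exists_riccati_limit`): the costs
decrease to a solution whose closed loop has no spectrum in the open right half-plane, and
observability excludes the imaginary axis. -/

open Filter Topology

/-! ### Hurwitz matrices and Lyapunov equations -/

section Hurwitz

variable {ι : Type*} [Fintype ι]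

theorem posSemidef_iff_real {X : Matrix ι ι ℝ} :
    X.PosSemidef ↔ Xᵀ = X ∧ ∀ x, 0 ≤ x ⬝ᵥ X *ᵥ x := by
  rw [Matrix.posSemidef_iff_dotProduct_mulVec, Matrix.IsHermitian,
    Matrix.conjTranspose_eq_transpose_of_trivial]
  simp

theorem dotProduct_mulVec_comm_of_symm {X : Matrix ι ι ℝ} (hX : Xᵀ = X) (x y : ι → ℝ) :
    x ⬝ᵥ X *ᵥ y = y ⬝ᵥ X *ᵥ x := by
  rw [Matrix.dotProduct_mulVec, ← Matrix.mulVec_transpose, hX, dotProduct_comm]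

theorem dotProduct_mulVec_lyapunov {X M P : Matrix ι ι ℝ} (hX : Xᵀ = X)
    (h : Mᵀ * X + X * M = P) (x : ι → ℝ) :
    2 * (x ⬝ᵥ X *ᵥ (M *ᵥ x)) = x ⬝ᵥ P *ᵥ x := by
  rw [← h, Matrix.add_mulVec, dotProduct_add, ← Matrix.mulVec_mulVec, ← Matrix.mulVec_mulVec,
    Matrix.dotProduct_mulVec x Mᵀ, Matrix.vecMul_transpose,
    dotProduct_mulVec_comm_of_symm hX (M *ᵥ x) x]
  ring

theorem map_mulVec_complex (M : Matrix ι ι ℝ) (x y : ι → ℝ) :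
    M.map (algebraMap ℝ ℂ) *ᵥ (fun i => (x i : ℂ) + y i * Complex.I) =
      fun i => ((M *ᵥ x) i : ℂ) + (M *ᵥ y) i * Complex.I := by
  ext i
  simp [Matrix.mulVec, dotProduct, mul_add, Finset.sum_add_distrib, Finset.sum_mul, mul_assoc]

/-- If `V x = x' X x` does not increase along `x' = M x`, it is constant along the real invariant
plane of an eigenvalue in the closed right half-plane. -/
theorem dissipation_eq_zero {X M : Matrix ι ι ℝ} (hX : X.PosSemidef)
    (hM : ∀ x, x ⬝ᵥ X *ᵥ (M *ᵥ x) ≤ 0) {σ ω : ℝ} {x y : ι → ℝ} (hσ : 0 ≤ σ)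
    (hx : M *ᵥ x = σ • x - ω • y) (hy : M *ᵥ y = ω • x + σ • y) :
    x ⬝ᵥ X *ᵥ (M *ᵥ x) = 0 ∧ y ⬝ᵥ X *ᵥ (M *ᵥ y) = 0 := by
  rw [posSemidef_iff_real] at hX
  have h1 := hM x
  have h2 := hM y
  -- The `ω` terms cancel by symmetry of `X`; the two nonpositive dissipations then have a
  -- nonnegative sum.
  have h3 : x ⬝ᵥ X *ᵥ (M *ᵥ x) + y ⬝ᵥ X *ᵥ (M *ᵥ y) =
      σ * (x ⬝ᵥ X *ᵥ x + y ⬝ᵥ X *ᵥ y) := by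
    rw [hx, hy]
    simp only [Matrix.mulVec_sub, Matrix.mulVec_add, Matrix.mulVec_smul, dotProduct_sub,
      dotProduct_add, dotProduct_smul, smul_eq_mul]
    rw [dotProduct_mulVec_comm_of_symm hX.1 y x]
    ring
  have h4 := mul_nonneg hσ (add_nonneg (hX.2 x) (hX.2 y))
  constructor <;> linarith

variable [DecidableEq ι]

theorem isHurwitz_iff_complex {M : Matrix ι ι ℝ} :
    IsHurwitz M ↔ ∀ (s : ℂ) (z : ι → ℂ), z ≠ 0 → M.map (algebraMap ℝ ℂ) *ᵥ z = s • z →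
      s.re < 0 := by
  have key : ∀ s : ℂ, s ∈ spectrum ℂ (M.map (algebraMap ℝ ℂ)) ↔
      ∃ z : ι → ℂ, z ≠ 0 ∧ M.map (algebraMap ℝ ℂ) *ᵥ z = s • z := by
    intro s
    rw [← Matrix.spectrum_toLin', ← Module.End.hasEigenvalue_iff_mem_spectrum]
    constructor
    · intro h
      obtain ⟨z, hz⟩ := h.exists_hasEigenvector
      exact ⟨z, hz.2, by simpa using hz.apply_eq_smul⟩
    · rintro ⟨z, hz, h⟩
      exact Module.End.hasEigenvalue_of_hasEigenvector (x := z)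
        ⟨Module.End.mem_eigenspace_iff.2 (by simpa using h), hz⟩
  unfold IsHurwitz
  simp_rw [key]
  grind

/-- Here `x + i y` is an eigenvector for `σ + i ω`; this form keeps all later quadratic-form
arguments real. -/
theorem isHurwitz_iff_real {M : Matrix ι ι ℝ} :
    IsHurwitz M ↔ ∀ (σ ω : ℝ) (x y : ι → ℝ), 0 ≤ σ → M *ᵥ x = σ • x - ω • y →
      M *ᵥ y = ω • x + σ • y → x = 0 ∧ y = 0 := by
  rw [isHurwitz_iff_complex]
  constructor
  · intro h σ ω x y hσ hx hy
    by_contra hne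
    have := h ⟨σ, ω⟩ (fun i => (x i : ℂ) + y i * Complex.I) ?_ ?_
    · exact absurd this (not_lt.2 hσ)
    · intro h0
      apply hne
      constructor <;> ext i
      · simpa using congrArg Complex.re (congrFun h0 i)
      · simpa using congrArg Complex.im (congrFun h0 i)
    · rw [map_mulVec_complex, hx, hy]
      ext i
      apply Complex.ext <;> simp
      ring
  · intro h s z hz hs
    by_contra! hre
    have e : z = fun i => (((z i).re : ℝ) : ℂ) + ((z i).im : ℝ) * Complex.I := by
      ext i; simp
    rw [e, map_mulVec_complex] at hs
    obtain ⟨h1, h2⟩ := h s.re s.im (fun i => (z i).re) (fun i => (z i).im) hre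
      (by ext i; simpa using congrArg Complex.re (congrFun hs i))
      (by
        ext i
        have := congrArg Complex.im (congrFun hs i)
        simp at this
        simp [this]; ring)
    apply hz
    rw [e]
    ext i
    simp [show (z i).re = 0 from congrFun h1 i, show (z i).im = 0 from congrFun h2 i]

/-- Gelfand's formula: eventually `‖C ^ k‖ ≤ r ^ k` for any `r` strictly between the spectral radius
and 1. -/
theorem tendsto_pow_zero_of_spectrum {C : Matrix ι ι ℂ} (h : ∀ s ∈ spectrum ℂ C, ‖s‖ < 1) :
    Tendsto (fun k : ℕ => C ^ k) atTop (𝓝 0) := by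
  let _ : NormedRing (Matrix ι ι ℂ) := Matrix.linftyOpNormedRing
  let _ : NormedAlgebra ℂ (Matrix ι ι ℂ) := Matrix.linftyOpNormedAlgebra
  have : CompleteSpace (Matrix ι ι ℂ) := FiniteDimensional.complete ℂ _
  rcases subsingleton_or_nontrivial (Matrix ι ι ℂ) with hs | hn
  · have : (fun k : ℕ => C ^ k) = fun _ => 0 := funext fun k => Subsingleton.elim _ _
    rw [this]
    exact tendsto_const_nhds
  have hr : spectralRadius ℂ C < (1 : NNReal) :=
    spectrum.spectralRadius_lt_of_forall_lt C fun s hs => h s hs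
  obtain ⟨r, hr1, hr2⟩ := ENNReal.lt_iff_exists_nnreal_btwn.1 hr
  have hr2' : r < 1 := by exact_mod_cast hr2
  have hev := (spectrum.pow_nnnorm_pow_one_div_tendsto_nhds_spectralRadius C).eventually_lt_const
    hr1
  have hb : ∀ᶠ k : ℕ in atTop, ‖C ^ k‖ ≤ (r : ℝ) ^ k := by
    filter_upwards [hev, eventually_gt_atTop 0] with k hk hk0
    have h1 : (‖C ^ k‖₊ : ENNReal) ≤ (r : ENNReal) ^ (k : ℝ) := by
      have := ENNReal.rpow_le_rpow hk.le (Nat.cast_nonneg k : (0 : ℝ) ≤ k)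
      rwa [← ENNReal.rpow_mul, one_div, inv_mul_cancel₀ (by positivity), ENNReal.rpow_one] at this
    rw [ENNReal.rpow_natCast] at h1
    exact_mod_cast h1
  exact squeeze_zero_norm' hb (tendsto_pow_atTop_nhds_zero_of_lt_one r.2 hr2')

/-- The Cayley transform of a Hurwitz matrix has powers that tend to `0`. -/
theorem IsHurwitz.exists_cayley {A : Matrix ι ι ℝ} (hA : IsHurwitz A) :
    ∃ J C : Matrix ι ι ℝ, (1 - A) * J = 1 ∧ (1 + A) * J = C ∧
      ∀ x, Tendsto (fun k : ℕ => C ^ k *ᵥ x) atTop (𝓝 0) := by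
  have hdet : IsUnit (1 - A).det := by
    rw [isUnit_iff_ne_zero]
    intro h0
    obtain ⟨v, hv, h⟩ := Matrix.exists_mulVec_eq_zero_iff.2 h0
    rw [Matrix.sub_mulVec, Matrix.one_mulVec, sub_eq_zero] at h
    exact hv (isHurwitz_iff_real.1 hA 1 0 v 0 zero_le_one (by simpa using h.symm) (by simp)).1
  have hinv := Matrix.mul_nonsing_inv _ hdet
  refine ⟨(1 - A)⁻¹, (1 + A) * (1 - A)⁻¹, hinv, rfl, fun x => ?_⟩
  set C := (1 + A) * (1 - A)⁻¹ with hC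
  have hcomm : (1 - A) * C = 1 + A := by
    rw [hC, ← mul_assoc, show (1 - A) * (1 + A) = (1 + A) * (1 - A) by noncomm_ring, mul_assoc,
      hinv, mul_one]
  have hspec : ∀ s ∈ spectrum ℂ (C.map (algebraMap ℝ ℂ)), ‖s‖ < 1 := by
    intro s hs
    rw [← Matrix.spectrum_toLin', ← Module.End.hasEigenvalue_iff_mem_spectrum] at hs
    obtain ⟨z, hz⟩ := hs.exists_hasEigenvector
    have hz0 : z ≠ 0 := hz.2
    have hz1 : C.map (algebraMap ℝ ℂ) *ᵥ z = s • z := by simpa using hz.apply_eq_smul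
    have hc := congrArg (fun M => M.map (algebraMap ℝ ℂ) *ᵥ z) hcomm
    simp only [Matrix.map_mul, Matrix.map_add _ (map_add (algebraMap ℝ ℂ)),
      Matrix.map_sub _ (map_sub (algebraMap ℝ ℂ)), ← Matrix.mulVec_mulVec, hz1,
      Matrix.map_one _ (map_zero (algebraMap ℝ ℂ)) (map_one (algebraMap ℝ ℂ)),
      Matrix.add_mulVec, Matrix.sub_mulVec, Matrix.one_mulVec, Matrix.mulVec_smul] at hc
    set w := A.map (algebraMap ℝ ℂ) *ᵥ z with hw
    -- An eigenvalue `s` of `C` comes from the eigenvalue `(s - 1) / (s + 1)` of `A`, whose real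
    -- part is negative exactly when `|s| < 1`.
    have h1 : (s + 1) • w = (s - 1) • z := by
      rw [add_smul, sub_smul, one_smul, one_smul]
      have : s • w = s • z - (z + w) := by rw [← hc, smul_sub]; abel
      rw [this]; abel
    have hs1 : s + 1 ≠ 0 := by
      intro h0
      have hs : s = -1 := eq_neg_of_add_eq_zero_left h0
      rw [h0, zero_smul, hs] at h1
      rcases smul_eq_zero.1 h1.symm with h | h
      · norm_num at h
      · exact hz0 h
    have h2 : w = ((s - 1) / (s + 1)) • z := by
      rw [div_eq_inv_mul, mul_smul, ← h1, smul_smul, inv_mul_cancel₀ hs1, one_smul]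
    have h3 := isHurwitz_iff_complex.1 hA _ z hz0 h2
    rw [Complex.div_re, ← add_div, div_neg_iff] at h3
    have hpos := Complex.normSq_pos.2 hs1
    have h4 : (s - 1).re * (s + 1).re + (s - 1).im * (s + 1).im < 0 := by
      rcases h3 with h | h
      · exact absurd h.2 (not_lt.2 hpos.le)
      · exact h.1
    have h5 : ‖s‖ ^ 2 < 1 := by
      rw [← Complex.normSq_eq_norm_sq, Complex.normSq_apply]
      simp at h4
      nlinarith
    exact (sq_lt_one_iff₀ (norm_nonneg _)).1 h5
  have ht := tendsto_pow_zero_of_spectrum hspec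
  have hR : Tendsto (fun k : ℕ => C ^ k) atTop (𝓝 0) := by
    have hcont : Continuous fun M : Matrix ι ι ℂ => M.map Complex.re :=
      Continuous.matrix_map continuous_id Complex.continuous_re
    have := (hcont.tendsto 0).comp ht
    have e : ((fun M : Matrix ι ι ℂ => M.map Complex.re) ∘
        fun k : ℕ => C.map (algebraMap ℝ ℂ) ^ k) = fun k => C ^ k := by
      ext k i j
      simp only [Function.comp]
      rw [← Matrix.map_pow]
      simp
    rw [e] at this
    simpa using this
  have hcont : Continuous fun M : Matrix ι ι ℝ => M *ᵥ x :=
    Continuous.matrix_mulVec continuous_id continuous_const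
  simpa [Function.comp_def] using (hcont.tendsto 0).comp hR

/-- The Cayley transform `C` replaces the flow of `A`. With `w = J x` one has `x = w - A w` and `C x
= w + A w`, so the form changes by `4 w' X A w ≤ 0` from `x` to `C x`; its values along `C ^ k x`
tend to 0. -/
theorem IsHurwitz.nonneg_of_lyapunov {A X : Matrix ι ι ℝ} (hA : IsHurwitz A) (hX : Xᵀ = X)
    (h : ∀ x, x ⬝ᵥ X *ᵥ (A *ᵥ x) ≤ 0) (x : ι → ℝ) : 0 ≤ x ⬝ᵥ X *ᵥ x := by
  obtain ⟨J, C, hJ, hC, ht⟩ := hA.exists_cayley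
  have hstep : ∀ x, (C *ᵥ x) ⬝ᵥ X *ᵥ (C *ᵥ x) ≤ x ⬝ᵥ X *ᵥ x := by
    intro x
    have e1 : x = J *ᵥ x - A *ᵥ (J *ᵥ x) := by
      conv_lhs => rw [← Matrix.one_mulVec x, ← hJ, ← Matrix.mulVec_mulVec, Matrix.sub_mulVec,
        Matrix.one_mulVec]
    have e2 : C *ᵥ x = J *ᵥ x + A *ᵥ (J *ᵥ x) := by
      rw [← hC, ← Matrix.mulVec_mulVec, Matrix.add_mulVec, Matrix.one_mulVec]
    rw [e2]
    conv_rhs => rw [e1]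
    have := h (J *ᵥ x)
    simp only [Matrix.mulVec_add, Matrix.mulVec_sub, dotProduct_add, dotProduct_sub,
      add_dotProduct, sub_dotProduct]
    rw [dotProduct_mulVec_comm_of_symm hX (A *ᵥ (J *ᵥ x)) (J *ᵥ x)]
    linarith
  have hk : ∀ k : ℕ, (C ^ k *ᵥ x) ⬝ᵥ X *ᵥ (C ^ k *ᵥ x) ≤ x ⬝ᵥ X *ᵥ x := by
    intro k
    induction k with
    | zero => simp
    | succ k ih =>
      rw [pow_succ', ← Matrix.mulVec_mulVec]
      exact (hstep _).trans ih
  have hcont : Continuous fun v : ι → ℝ => v ⬝ᵥ X *ᵥ v :=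
    continuous_id.dotProduct (Continuous.matrix_mulVec continuous_const continuous_id)
  have := (hcont.tendsto 0).comp (ht x)
  simp only [Matrix.mulVec_zero, dotProduct_zero] at this
  exact le_of_tendsto' this hk

/-- The bilinear form of `X` is invariant under `C`, whose powers tend to 0. Symmetry of `X` is not
available here: this uniqueness is what yields it in `exists_lyapunov`. -/
theorem IsHurwitz.eq_zero_of_lyapunov {A X : Matrix ι ι ℝ} (hA : IsHurwitz A)
    (h : Aᵀ * X + X * A = 0) : X = 0 := by
  obtain ⟨J, C, hJ, hC, ht⟩ := hA.exists_cayley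
  have hstep : ∀ x y, (C *ᵥ x) ⬝ᵥ X *ᵥ (C *ᵥ y) = x ⬝ᵥ X *ᵥ y := by
    intro x y
    have e1 : ∀ x, x = J *ᵥ x - A *ᵥ (J *ᵥ x) := by
      intro x
      conv_lhs => rw [← Matrix.one_mulVec x, ← hJ, ← Matrix.mulVec_mulVec, Matrix.sub_mulVec,
        Matrix.one_mulVec]
    have e2 : ∀ x, C *ᵥ x = J *ᵥ x + A *ᵥ (J *ᵥ x) := by
      intro x
      rw [← hC, ← Matrix.mulVec_mulVec, Matrix.add_mulVec, Matrix.one_mulVec]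
    rw [e2, e2]
    conv_rhs => rw [e1 x, e1 y]
    have h0 : ∀ x y, (A *ᵥ x) ⬝ᵥ X *ᵥ y + x ⬝ᵥ X *ᵥ (A *ᵥ y) = 0 := by
      intro x y
      have := congrArg (fun M => x ⬝ᵥ M *ᵥ y) h
      simpa [Matrix.add_mulVec, ← Matrix.mulVec_mulVec, Matrix.dotProduct_mulVec x Aᵀ,
        Matrix.vecMul_transpose] using this
    have := h0 (J *ᵥ x) (J *ᵥ y)
    simp only [Matrix.mulVec_add, Matrix.mulVec_sub, dotProduct_add, dotProduct_sub,
      add_dotProduct, sub_dotProduct]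
    linarith
  have hk : ∀ x y (k : ℕ), (C ^ k *ᵥ x) ⬝ᵥ X *ᵥ (C ^ k *ᵥ y) = x ⬝ᵥ X *ᵥ y := by
    intro x y k
    induction k with
    | zero => simp
    | succ k ih =>
      rw [pow_succ', ← Matrix.mulVec_mulVec, ← Matrix.mulVec_mulVec, hstep, ih]
  have hz : ∀ x y, x ⬝ᵥ X *ᵥ y = 0 := by
    intro x y
    have hcont : Continuous fun v : (ι → ℝ) × (ι → ℝ) => v.1 ⬝ᵥ X *ᵥ v.2 :=
      continuous_fst.dotProduct (Continuous.matrix_mulVec continuous_const continuous_snd)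
    have := (hcont.tendsto (0, 0)).comp ((ht x).prodMk_nhds (ht y))
    simp only [Matrix.mulVec_zero, dotProduct_zero, Function.comp_def, hk] at this
    exact tendsto_nhds_unique tendsto_const_nhds this
  ext i j
  simpa using hz (Pi.single i 1) (Pi.single j 1)

/-- The Lyapunov operator is injective on a finite-dimensional space, hence onto; `Xᵀ` solves the
same equation as `X`. -/
theorem IsHurwitz.exists_lyapunov {A P : Matrix ι ι ℝ} (hA : IsHurwitz A) (hP : P.PosSemidef) :
    ∃ X : Matrix ι ι ℝ, X.PosSemidef ∧ Aᵀ * X + X * A = -P := by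
  let Φ : Matrix ι ι ℝ →ₗ[ℝ] Matrix ι ι ℝ :=
    LinearMap.mulLeft ℝ Aᵀ + LinearMap.mulRight ℝ A
  have hinj : Function.Injective Φ := by
    rw [injective_iff_map_eq_zero]
    intro X hX
    exact hA.eq_zero_of_lyapunov hX
  obtain ⟨X, hX⟩ := LinearMap.surjective_of_injective hinj (-P)
  replace hX : Aᵀ * X + X * A = -P := hX
  rw [posSemidef_iff_real] at hP
  have hsymm : Xᵀ = X := by
    rw [← sub_eq_zero]
    apply hA.eq_zero_of_lyapunov
    have := congrArg Matrix.transpose hX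
    simp only [Matrix.transpose_add, Matrix.transpose_mul, Matrix.transpose_transpose,
      Matrix.transpose_neg, hP.1] at this
    rw [mul_sub, sub_mul, sub_add_sub_comm, hX, add_comm, this, sub_self]
  refine ⟨X, posSemidef_iff_real.2 ⟨hsymm, hA.nonneg_of_lyapunov hsymm fun x => ?_⟩, hX⟩
  have h1 := dotProduct_mulVec_lyapunov hsymm hX x
  have h2 := hP.2 x
  rw [Matrix.neg_mulVec, dotProduct_neg] at h1
  linarith

end Hurwitz

/-! ### Riccati equations by policy iteration -/

section Riccati

variable {ι κ : Type*} [Fintype ι] [Fintype κ]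

theorem dotProduct_mulVec_input {X : Matrix ι ι ℝ} (hX : Xᵀ = X) (B : Matrix ι κ ℝ)
    (x : ι → ℝ) (w : κ → ℝ) : x ⬝ᵥ X *ᵥ (B *ᵥ w) = ((Bᵀ * X) *ᵥ x) ⬝ᵥ w := by
  rw [Matrix.mulVec_mulVec, Matrix.dotProduct_mulVec, ← Matrix.mulVec_transpose,
    Matrix.transpose_mul, hX]

theorem dotProduct_transpose_mul_mulVec (K : Matrix κ ι ℝ) (x : ι → ℝ) :
    x ⬝ᵥ (Kᵀ * K) *ᵥ x = (K *ᵥ x) ⬝ᵥ (K *ᵥ x) := by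
  rw [← Matrix.mulVec_mulVec, Matrix.dotProduct_mulVec, Matrix.vecMul_transpose]

theorem dotProduct_self_nonneg_real (x : ι → ℝ) : 0 ≤ x ⬝ᵥ x :=
  Finset.sum_nonneg fun i _ => mul_self_nonneg (x i)

theorem posSemidef_weight {Q : Matrix ι ι ℝ} (hQ : Q.PosSemidef) (K : Matrix κ ι ℝ) :
    (Q + Kᵀ * K).PosSemidef := by
  have h := Matrix.posSemidef_conjTranspose_mul_self K
  rw [Matrix.conjTranspose_eq_transpose_of_trivial] at h
  exact hQ.add h

/-- The Lyapunov equation makes `X` the cost matrix of the gain `K`: its form decreases at the rate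
of the running cost. -/
theorem dissipation_cost {A Q X : Matrix ι ι ℝ} {B : Matrix ι κ ℝ} {K : Matrix κ ι ℝ}
    (hX : Xᵀ = X)
    (h : (A - B * K)ᵀ * X + X * (A - B * K) = -(Q + Kᵀ * K)) (x : ι → ℝ) :
    2 * (x ⬝ᵥ X *ᵥ ((A - B * K) *ᵥ x)) = -(x ⬝ᵥ Q *ᵥ x) - (K *ᵥ x) ⬝ᵥ (K *ᵥ x) := by
  rw [dotProduct_mulVec_lyapunov hX h, Matrix.neg_mulVec, Matrix.add_mulVec, dotProduct_neg,
    dotProduct_add, dotProduct_transpose_mul_mulVec]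
  ring

/-- Completion of squares when the gain `K` is replaced by `B' X`, with `X` the cost of `K`. -/
theorem dissipation_improved {A Q X : Matrix ι ι ℝ} {B : Matrix ι κ ℝ} {K : Matrix κ ι ℝ}
    (hX : Xᵀ = X)
    (h : (A - B * K)ᵀ * X + X * (A - B * K) = -(Q + Kᵀ * K)) (x : ι → ℝ) :
    2 * (x ⬝ᵥ X *ᵥ ((A - B * (Bᵀ * X)) *ᵥ x)) = -(x ⬝ᵥ Q *ᵥ x)
      - (K *ᵥ x - (Bᵀ * X) *ᵥ x) ⬝ᵥ (K *ᵥ x - (Bᵀ * X) *ᵥ x)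
      - ((Bᵀ * X) *ᵥ x) ⬝ᵥ ((Bᵀ * X) *ᵥ x) := by
  have h1 := dissipation_cost hX h x
  have e : (A - B * (Bᵀ * X)) *ᵥ x =
      (A - B * K) *ᵥ x + B *ᵥ (K *ᵥ x - (Bᵀ * X) *ᵥ x) := by
    simp only [Matrix.sub_mulVec, Matrix.mulVec_sub, ← Matrix.mulVec_mulVec]
    abel
  rw [e, Matrix.mulVec_add, dotProduct_add, dotProduct_mulVec_input hX B]
  set v := (Bᵀ * X) *ᵥ x
  set u := K *ᵥ x
  simp only [dotProduct_sub, sub_dotProduct]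
  rw [dotProduct_comm u v]
  linarith

variable [DecidableEq ι]

/-- Where the dissipation vanishes, the completed square forces `K x = B' X x`, so an unstable mode
of the new loop would be one of the old loop. -/
theorem isHurwitz_improved {A Q X : Matrix ι ι ℝ} {B : Matrix ι κ ℝ} {K : Matrix κ ι ℝ}
    (hK : IsHurwitz (A - B * K)) (hQ : Q.PosSemidef) (hX : X.PosSemidef)
    (h : (A - B * K)ᵀ * X + X * (A - B * K) = -(Q + Kᵀ * K)) :
    IsHurwitz (A - B * (Bᵀ * X)) := by
  have hX' := posSemidef_iff_real.1 hX
  have hQ' := posSemidef_iff_real.1 hQ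
  have hd := dissipation_improved hX'.1 h
  rw [isHurwitz_iff_real]
  intro σ ω x y hσ hx hy
  obtain ⟨h1, h2⟩ := dissipation_eq_zero hX (fun x => by
    have := hd x
    have := hQ'.2 x
    have := dotProduct_self_nonneg_real (K *ᵥ x - (Bᵀ * X) *ᵥ x)
    have := dotProduct_self_nonneg_real ((Bᵀ * X) *ᵥ x)
    linarith) hσ hx hy
  have key : ∀ x, x ⬝ᵥ X *ᵥ ((A - B * (Bᵀ * X)) *ᵥ x) = 0 →
      (A - B * (Bᵀ * X)) *ᵥ x = (A - B * K) *ᵥ x := by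
    intro x h0
    have := hd x
    have := hQ'.2 x
    have := dotProduct_self_nonneg_real (K *ᵥ x - (Bᵀ * X) *ᵥ x)
    have := dotProduct_self_nonneg_real ((Bᵀ * X) *ᵥ x)
    have hz : K *ᵥ x - (Bᵀ * X) *ᵥ x = 0 := dotProduct_self_eq_zero.1 (by linarith)
    rw [sub_eq_zero] at hz
    rw [Matrix.sub_mulVec, Matrix.sub_mulVec, ← Matrix.mulVec_mulVec, ← hz, Matrix.mulVec_mulVec]
  rw [key x h1] at hx
  rw [key y h2] at hy
  exact isHurwitz_iff_real.1 hK σ ω x y hσ hx hy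

/-- Along the improved loop the form of `X - Y` changes at rate `-|K x - B' X x|²`. -/
theorem cost_improved_le {A Q X Y : Matrix ι ι ℝ} {B : Matrix ι κ ℝ} {K : Matrix κ ι ℝ}
    (hK : IsHurwitz (A - B * (Bᵀ * X))) (hX : X.PosSemidef) (hY : Y.PosSemidef)
    (h : (A - B * K)ᵀ * X + X * (A - B * K) = -(Q + Kᵀ * K))
    (h' : (A - B * (Bᵀ * X))ᵀ * Y + Y * (A - B * (Bᵀ * X)) = -(Q + (Bᵀ * X)ᵀ * (Bᵀ * X)))
    (x : ι → ℝ) : x ⬝ᵥ Y *ᵥ x ≤ x ⬝ᵥ X *ᵥ x := by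
  have hX' := posSemidef_iff_real.1 hX
  have hY' := posSemidef_iff_real.1 hY
  have := hK.nonneg_of_lyapunov (X := X - Y) (by rw [Matrix.transpose_sub, hX'.1, hY'.1])
    (fun x => by
      rw [Matrix.sub_mulVec, dotProduct_sub]
      have h1 := dissipation_improved hX'.1 h x
      have h2 := dissipation_cost hY'.1 h' x
      have := dotProduct_self_nonneg_real (K *ᵥ x - (Bᵀ * X) *ᵥ x)
      linarith) x
  rw [Matrix.sub_mulVec, dotProduct_sub] at this
  linarith

/-- Each root `r` satisfies `|s - r| ≥ Re s`. The bound does not depend on `A`, so it survives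
limits. -/
theorem IsHurwitz.re_pow_le_norm_det {A : Matrix ι ι ℝ} (hA : IsHurwitz A) {s : ℂ}
    (hs : 0 ≤ s.re) :
    s.re ^ Fintype.card ι ≤ ‖(A.map (algebraMap ℝ ℂ)).charpoly.eval s‖ := by
  set M := A.map (algebraMap ℝ ℂ)
  rw [(IsAlgClosed.splits M.charpoly).eval_eq_prod_roots_of_monic M.charpoly_monic,
    ← M.charpoly_natDegree_eq_dim,
    (IsAlgClosed.splits M.charpoly).natDegree_eq_card_roots]
  have : ∀ r ∈ M.charpoly.roots, s.re ≤ ‖s - r‖ := by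
    intro r hr
    have hr' := hA r (Matrix.mem_spectrum_iff_isRoot_charpoly.2 (Polynomial.isRoot_of_mem_roots hr))
    have := Complex.re_le_norm (s - r)
    rw [Complex.sub_re] at this
    linarith
  revert this
  generalize M.charpoly.roots = R
  intro this
  induction R using Multiset.induction_on with
  | empty => simp
  | cons r R ih =>
    rw [Multiset.card_cons, pow_succ', Multiset.map_cons, Multiset.prod_cons, norm_mul]
    exact mul_le_mul (this r (Multiset.mem_cons_self r R))
      (ih fun q hq => this q (Multiset.mem_cons_of_mem hq)) (by positivity) (norm_nonneg _)

/-- The eigenvalues of a limit of Hurwitz matrices lie in the closed left half-plane. -/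
theorem re_le_zero_of_tendsto_isHurwitz {M : ℕ → Matrix ι ι ℝ} {L : Matrix ι ι ℝ}
    (hM : ∀ k, IsHurwitz (M k)) (hL : Tendsto M atTop (𝓝 L)) {s : ℂ}
    (hs : s ∈ spectrum ℂ (L.map (algebraMap ℝ ℂ))) : s.re ≤ 0 := by
  by_contra! hpos
  have hcont : Continuous fun P : Matrix ι ι ℝ => ‖(P.map (algebraMap ℝ ℂ)).charpoly.eval s‖ := by
    simp_rw [Matrix.eval_charpoly]
    exact (Continuous.matrix_det (continuous_const.sub
      (Continuous.matrix_map continuous_id Complex.continuous_ofReal))).norm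
  have h1 := ge_of_tendsto' ((hcont.tendsto L).comp hL) fun k => (hM k).re_pow_le_norm_det hpos.le
  have h2 : (L.map (algebraMap ℝ ℂ)).charpoly.eval s = 0 :=
    Matrix.mem_spectrum_iff_isRoot_charpoly.1 hs
  rw [h2, norm_zero] at h1
  exact absurd h1 (not_le.2 (by positivity))

/-- Polarization recovers the entries from quadratic forms, which converge because they decrease and
are bounded below by 0. -/
theorem exists_tendsto_of_antitone_posSemidef {X : ℕ → Matrix ι ι ℝ}
    (hX : ∀ k, (X k).PosSemidef) (hmono : ∀ k x, x ⬝ᵥ X (k + 1) *ᵥ x ≤ x ⬝ᵥ X k *ᵥ x) :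
    ∃ L : Matrix ι ι ℝ, L.PosSemidef ∧ Tendsto X atTop (𝓝 L) := by
  have hX' := fun k => posSemidef_iff_real.1 (hX k)
  have hq : ∀ x, ∃ l, Tendsto (fun k => x ⬝ᵥ X k *ᵥ x) atTop (𝓝 l) := fun x =>
    ⟨_, tendsto_atTop_ciInf (antitone_nat_of_succ_le fun k => hmono k x)
      ⟨0, by rintro _ ⟨k, rfl⟩; exact (hX' k).2 x⟩⟩
  choose q hq using hq
  have he : ∀ i j, ∃ l, Tendsto (fun k => X k i j) atTop (𝓝 l) := by
    intro i j
    let a : ι → ℝ := Pi.single i 1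
    let b : ι → ℝ := Pi.single j 1
    refine ⟨_, ((((hq (a + b)).sub (hq a)).sub (hq b)).const_mul (1 / 2)).congr fun k => ?_⟩
    have e : X k i j = a ⬝ᵥ X k *ᵥ b := by simp [a, b]
    rw [e]
    simp only [Matrix.mulVec_add, dotProduct_add, add_dotProduct]
    rw [dotProduct_mulVec_comm_of_symm (hX' k).1 b a]
    ring
  choose L hL using he
  have ht : Tendsto X atTop (𝓝 (Matrix.of L)) :=
    tendsto_pi_nhds.2 fun i => tendsto_pi_nhds.2 fun j => hL i j
  refine ⟨Matrix.of L, posSemidef_iff_real.2 ⟨?_, fun x => ?_⟩, ht⟩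
  · have hc : Continuous fun M : Matrix ι ι ℝ => Mᵀ := Continuous.matrix_transpose continuous_id
    refine tendsto_nhds_unique ((hc.tendsto _).comp ht) (ht.congr fun k => ?_)
    exact (hX' k).1.symm
  · have hc : Continuous fun M : Matrix ι ι ℝ => x ⬝ᵥ M *ᵥ x :=
      continuous_const.dotProduct (Continuous.matrix_mulVec continuous_id continuous_const)
    exact ge_of_tendsto' ((hc.tendsto _).comp ht) fun k => (hX' k).2 x

/-- Policy iteration produces a positive semidefinite solution of the Riccati equation whose closed
loop matrix is a limit of Hurwitz matrices. -/
theorem exists_riccati_limit {A Q : Matrix ι ι ℝ} {B : Matrix ι κ ℝ} {K : Matrix κ ι ℝ}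
    (hK : IsHurwitz (A - B * K)) (hQ : Q.PosSemidef) :
    ∃ X : Matrix ι ι ℝ, X.PosSemidef ∧ Aᵀ * X + X * A - X * B * Bᵀ * X + Q = 0 ∧
      ∀ s ∈ spectrum ℂ ((A - B * (Bᵀ * X)).map (algebraMap ℝ ℂ)), s.re ≤ 0 := by
  choose f hf1 hf2 using fun K : {K : Matrix κ ι ℝ // IsHurwitz (A - B * K)} =>
    K.2.exists_lyapunov (posSemidef_weight hQ K.1)
  let next : {K : Matrix κ ι ℝ // IsHurwitz (A - B * K)} →
      {K : Matrix κ ι ℝ // IsHurwitz (A - B * K)} :=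
    fun K => ⟨Bᵀ * f K, isHurwitz_improved K.2 hQ (hf1 K) (hf2 K)⟩
  let g : ℕ → {K : Matrix κ ι ℝ // IsHurwitz (A - B * K)} := fun k => next^[k] ⟨K, hK⟩
  have hg : ∀ k, (g (k + 1)).1 = Bᵀ * f (g k) := by
    intro k
    simp only [g, Function.iterate_succ_apply']
    rfl
  obtain ⟨X, hX, ht⟩ := exists_tendsto_of_antitone_posSemidef (X := fun k => f (g k))
    (fun k => hf1 _) (fun k x => by
      have h2 := hf2 (g (k + 1))
      have h3 := (g (k + 1)).2
      rw [hg] at h2 h3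
      exact cost_improved_le h3 (hf1 _) (hf1 _) (hf2 (g k)) h2 x)
  have hX' := posSemidef_iff_real.1 hX
  have htc : Tendsto (fun k => A - B * (Bᵀ * f (g k))) atTop (𝓝 (A - B * (Bᵀ * X))) := by
    have hc : Continuous fun Y : Matrix ι ι ℝ => A - B * (Bᵀ * Y) := by fun_prop
    exact (hc.tendsto _).comp ht
  refine ⟨X, hX, ?_, fun s hs => re_le_zero_of_tendsto_isHurwitz (fun k => ?_) htc hs⟩
  -- The Lyapunov equation links consecutive costs, the gain being built from the earlier one; when
  -- both tend to `X` it becomes the Riccati equation.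
  · have hc : Continuous fun p : Matrix ι ι ℝ × Matrix ι ι ℝ =>
        (A - B * (Bᵀ * p.1))ᵀ * p.2 + p.2 * (A - B * (Bᵀ * p.1)) +
          (Q + (Bᵀ * p.1)ᵀ * (Bᵀ * p.1)) := by fun_prop
    have hlim := (hc.tendsto (X, X)).comp (ht.prodMk_nhds (ht.comp (tendsto_add_atTop_nat 1)))
    have h0 := tendsto_nhds_unique hlim (tendsto_const_nhds.congr fun k => by
      have h2 := hf2 (g (k + 1))
      rw [hg] at h2
      simp only [Function.comp]
      rw [h2, neg_add_cancel])
    rw [← h0]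
    simp only [Matrix.transpose_sub, Matrix.transpose_mul, Matrix.transpose_transpose, hX'.1,
      mul_sub, sub_mul, ← mul_assoc, ← Matrix.mul_assoc]
    abel
  · have := (g (k + 1)).2
    rwa [hg] at this

end Riccati

/-- An unstable mode of the limiting loop must have `σ = 0` and zero dissipation, hence `B' X z = 0`
and `R z = 0`: it is an imaginary mode of `A` annihilated by `R`. -/
theorem exists_isStabilizingSolution {n m : ℕ} {A Q : Matrix (Fin n) (Fin n) ℝ}
    {B : Matrix (Fin n) (Fin m) ℝ} (hAB : IsStabilizable A B) (hQ : IsAdmissibleWeight A Q) :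
    ∃ X, IsStabilizingSolution A B Q X := by
  obtain ⟨K, hK⟩ := hAB
  obtain ⟨hQ, R, hR, hRR, hobs⟩ := hQ
  obtain ⟨X, hX, hric, hre⟩ := exists_riccati_limit hK hQ
  have hX' := posSemidef_iff_real.1 hX
  have hQ' := posSemidef_iff_real.1 hQ
  have hR' := posSemidef_iff_real.1 hR
  refine ⟨X, hX, hric, ?_⟩
  -- The Riccati equation is the Lyapunov cost equation for the gain `K = B' X`.
  have hd : ∀ x, 2 * (x ⬝ᵥ X *ᵥ ((A - B * (Bᵀ * X)) *ᵥ x)) =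
      -(x ⬝ᵥ Q *ᵥ x) - ((Bᵀ * X) *ᵥ x) ⬝ᵥ ((Bᵀ * X) *ᵥ x) := by
    apply dissipation_cost hX'.1
    rw [← sub_eq_zero, ← hric]
    simp only [Matrix.transpose_sub, Matrix.transpose_mul, Matrix.transpose_transpose, hX'.1,
      mul_sub, sub_mul, ← Matrix.mul_assoc]
    abel
  rw [isHurwitz_iff_real]
  intro σ ω x y hσ hx hy
  obtain ⟨h1, h2⟩ := dissipation_eq_zero hX (fun x => by
    have := hd x
    have := hQ'.2 x
    have := dotProduct_self_nonneg_real ((Bᵀ * X) *ᵥ x)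
    linarith) hσ hx hy
  have key : ∀ x, x ⬝ᵥ X *ᵥ ((A - B * (Bᵀ * X)) *ᵥ x) = 0 →
      (A - B * (Bᵀ * X)) *ᵥ x = A *ᵥ x ∧ R *ᵥ x = 0 := by
    intro x h0
    have := hd x
    have hq := hQ'.2 x
    have := dotProduct_self_nonneg_real ((Bᵀ * X) *ᵥ x)
    have hz : (Bᵀ * X) *ᵥ x = 0 := dotProduct_self_eq_zero.1 (by linarith)
    have hr : x ⬝ᵥ Q *ᵥ x = (R *ᵥ x) ⬝ᵥ (R *ᵥ x) := by
      rw [← dotProduct_transpose_mul_mulVec, hR'.1, hRR]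
    refine ⟨?_, dotProduct_self_eq_zero.1 (by linarith)⟩
    rw [Matrix.sub_mulVec, ← Matrix.mulVec_mulVec, hz, Matrix.mulVec_zero, sub_zero]
  obtain ⟨hax, hrx⟩ := key x h1
  obtain ⟨hay, hry⟩ := key y h2
  by_contra hne
  set z : Fin n → ℂ := fun i => (x i : ℂ) + y i * Complex.I with hz
  have hz0 : z ≠ 0 := by
    intro h0
    apply hne
    constructor <;> ext i
    · simpa [hz] using congrArg Complex.re (congrFun h0 i)
    · simpa [hz] using congrArg Complex.im (congrFun h0 i)
  have heig : (A - B * (Bᵀ * X)).map (algebraMap ℝ ℂ) *ᵥ z = (⟨σ, ω⟩ : ℂ) • z := by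
    rw [hz, map_mulVec_complex, hx, hy]
    ext i
    apply Complex.ext <;> simp
    ring
  have hs : (⟨σ, ω⟩ : ℂ) ∈ spectrum ℂ ((A - B * (Bᵀ * X)).map (algebraMap ℝ ℂ)) := by
    rw [← Matrix.spectrum_toLin', ← Module.End.hasEigenvalue_iff_mem_spectrum]
    exact Module.End.hasEigenvalue_of_hasEigenvector (x := z)
      ⟨Module.End.mem_eigenspace_iff.2 (by simpa using heig), hz0⟩
  have hσ0 : σ = 0 := le_antisymm (hre _ hs) hσ
  apply hz0
  apply hobs ω
  · rw [hz, map_mulVec_complex, ← hax, ← hay, ← map_mulVec_complex, ← hz, heig, hσ0]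
    congr 1
    apply Complex.ext <;> simp
  · rw [hz, map_mulVec_complex, hrx, hry]
    ext i
    simp

/-! ### The pinned Laplacian as an M-matrix -/

namespace WeightedDigraph

variable {N : ℕ} (G : WeightedDigraph N) (iR : Fin N)

theorem laplacian_mulVec (x : Fin N → ℝ) (i : Fin N) :
    (G.laplacian *ᵥ x) i = ∑ j, G.a i j * (x i - x j) := by
  rw [laplacian, Matrix.sub_mulVec, Pi.sub_apply, Matrix.mulVec_diagonal]
  simp only [Matrix.mulVec, dotProduct, mul_sub, Finset.sum_sub_distrib, Finset.sum_mul]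

theorem pinned_mulVec (x : Fin N → ℝ) (i : Fin N) :
    ((G.laplacian + Matrix.single iR iR 1) *ᵥ x) i =
      ∑ j, G.a i j * (x i - x j) + if i = iR then x i else 0 := by
  rw [Matrix.add_mulVec, Pi.add_apply, laplacian_mulVec, Matrix.single_mulVec]
  by_cases h : i = iR
  · subst h; simp
  · simp [h]

theorem pinnedLaplacian_mulVec (d x : Fin N → ℝ) (i : Fin N) :
    (G.pinnedLaplacian iR d *ᵥ x) i =
      d i * (∑ j, G.a i j * (x i - x j) + if i = iR then x i else 0) := by
  rw [pinnedLaplacian, ← Matrix.mulVec_mulVec, Matrix.mulVec_diagonal, pinned_mulVec]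

variable {G iR}

/-- Minimum principle: the pinned Laplacian is inverse-positive. -/
theorem nonneg_of_pinned_mulVec_nonneg (hR : G.IsReachable iR) {x : Fin N → ℝ}
    (hx : ∀ i, 0 ≤ ((G.laplacian + Matrix.single iR iR 1) *ᵥ x) i) (i : Fin N) : 0 ≤ x i := by
  have : Nonempty (Fin N) := ⟨i⟩
  obtain ⟨k, hk⟩ := Finite.exists_min x
  by_contra! hi
  have hneg : x k < 0 := (hk i).trans_lt hi
  have hterm : ∀ l, x l = x k → ∀ j, G.a l j * (x l - x j) ≤ 0 := fun l hl j =>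
    mul_nonpos_of_nonneg_of_nonpos (G.nonneg l j) (by rw [hl]; linarith [hk j])
  -- At a node with the negative minimum all terms of the row are nonpositive, so they vanish: the
  -- minimum spreads along edges, and the pinning term bars it from `iR`.
  have hstep : ∀ l, x l = x k → l ≠ iR ∧ ∀ j, G.Edge l j → x j = x k := by
    intro l hl
    have h := hx l
    rw [pinned_mulVec] at h
    have hs := Finset.sum_nonpos fun j (_ : j ∈ Finset.univ) => hterm l hl j
    have hne : l ≠ iR := by
      intro e
      rw [if_pos e] at h
      linarith
    rw [if_neg hne, add_zero] at h
    refine ⟨hne, fun j hj => ?_⟩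
    have h0 := (Finset.sum_eq_zero_iff_of_nonpos fun j _ => hterm l hl j).1 (le_antisymm hs h) j
      (Finset.mem_univ j)
    rcases mul_eq_zero.1 h0 with h0 | h0
    · exact absurd h0 (ne_of_gt hj)
    · linarith
  have hall : ∀ j, Relation.ReflTransGen G.Edge k j → x j = x k := by
    intro j hj
    induction hj with
    | refl => rfl
    | tail _ hbc ih => exact (hstep _ ih).2 _ hbc
  exact (hstep iR (hall iR (hR k))).1 rfl

theorem isUnit_det_pinned (hR : G.IsReachable iR) :
    IsUnit (G.laplacian + Matrix.single iR iR 1).det := by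
  rw [isUnit_iff_ne_zero]
  intro h0
  obtain ⟨v, hv, h⟩ := Matrix.exists_mulVec_eq_zero_iff.2 h0
  apply hv
  ext i
  apply le_antisymm
  · have := nonneg_of_pinned_mulVec_nonneg hR (x := -v) (by simp [Matrix.mulVec_neg, h]) i
    simpa using this
  · exact nonneg_of_pinned_mulVec_nonneg hR (by simp [h]) i

/-- Take the column sums of `H⁻¹`: its entries are nonnegative by the minimum principle, and no
column of an invertible matrix is zero. -/
theorem exists_pos_vecMul_pinned_eq_one (hR : G.IsReachable iR) :
    ∃ y : Fin N → ℝ, (∀ i, 0 < y i) ∧ y ᵥ* (G.laplacian + Matrix.single iR iR 1) = 1 := by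
  have hdet := isUnit_det_pinned hR
  set H := G.laplacian + Matrix.single iR iR 1 with hH
  have hnn : ∀ i j, 0 ≤ H⁻¹ i j := by
    intro i j
    have e : H⁻¹ i j = (H⁻¹ *ᵥ Pi.single j 1) i := by simp
    rw [e]
    apply nonneg_of_pinned_mulVec_nonneg hR
    intro k
    rw [Matrix.mulVec_mulVec, Matrix.mul_nonsing_inv _ hdet, Matrix.one_mulVec]
    exact (Pi.single_nonneg.2 zero_le_one : (0 : Fin N → ℝ) ≤ Pi.single j 1) k
  refine ⟨1 ᵥ* H⁻¹, fun j => ?_, ?_⟩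
  · have e : (1 ᵥ* H⁻¹) j = ∑ i, H⁻¹ i j := by simp [Matrix.vecMul, dotProduct]
    rw [e]
    refine (Finset.sum_nonneg fun i _ => hnn i j).lt_of_ne' fun h0 => ?_
    have hz := (Finset.sum_eq_zero_iff_of_nonneg fun i _ => hnn i j).1 h0
    have h1 : (H * H⁻¹) j j = 1 := by rw [Matrix.mul_nonsing_inv _ hdet, Matrix.one_apply_eq]
    rw [Matrix.mul_apply, Finset.sum_eq_zero fun i hi => by rw [hz i hi, mul_zero]] at h1
    exact zero_ne_one h1
  · rw [Matrix.vecMul_vecMul, Matrix.nonsing_inv_mul _ hdet, Matrix.vecMul_one]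

/-- Diagonal stability of the pinned Laplacian. -/
theorem exists_pos_pinnedLaplacian_coercive (hR : G.IsReachable iR) :
    ∃ d : Fin N → ℝ, (∀ i, 0 < d i) ∧
      ∀ z : Fin N → ℝ, z ⬝ᵥ z ≤ z ⬝ᵥ G.pinnedLaplacian iR d *ᵥ z := by
  obtain ⟨y, hy, hyH⟩ := exists_pos_vecMul_pinned_eq_one hR
  -- The factor 2 matches `2 z_i (z_i - z_j) ≥ z_i² - z_j²`; pairing `y` with `H` applied to the
  -- squares `z_i²` gives exactly `z' z`.
  refine ⟨fun i => 2 * y i, fun i => by have := hy i; positivity, fun z => ?_⟩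
  have h1 : z ⬝ᵥ z = ∑ i, y i * (∑ j, G.a i j * (z i ^ 2 - z j ^ 2) +
      if i = iR then z i ^ 2 else 0) := by
    have h2 : y ⬝ᵥ ((G.laplacian + Matrix.single iR iR 1) *ᵥ fun i => z i ^ 2) = z ⬝ᵥ z := by
      rw [Matrix.dotProduct_mulVec, hyH]
      simp [dotProduct, sq]
    rw [← h2]
    exact Finset.sum_congr rfl fun i _ => by rw [pinned_mulVec]
  rw [h1]
  refine Finset.sum_le_sum fun i _ => ?_
  rw [pinnedLaplacian_mulVec]
  have e : z i * (2 * y i * (∑ j, G.a i j * (z i - z j) + if i = iR then z i else 0)) =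
      y i * (∑ j, G.a i j * (2 * z i * (z i - z j)) + if i = iR then 2 * z i ^ 2 else 0) := by
    have : ∑ j, G.a i j * (2 * z i * (z i - z j)) = 2 * z i * ∑ j, G.a i j * (z i - z j) := by
      rw [Finset.mul_sum]
      exact Finset.sum_congr rfl fun j _ => by ring
    rw [this]
    split_ifs <;> ring
  rw [e]
  refine mul_le_mul_of_nonneg_left (add_le_add (Finset.sum_le_sum fun j _ => ?_) ?_) (hy i).le
  · exact mul_le_mul_of_nonneg_left (by nlinarith [sq_nonneg (z i - z j)]) (G.nonneg i j)
  · split_ifs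
    · nlinarith [sq_nonneg (z i)]
    · exact le_rfl

end WeightedDigraph

/-! ### Stacked vectors and block diagonal matrices -/

section Stack

variable {N : ℕ} {n m : Fin N → ℕ}

theorem stack_dotProduct (x y : ∀ i, Fin (n i) → ℝ) :
    stack x ⬝ᵥ stack y = ∑ i, x i ⬝ᵥ y i := by
  simp only [dotProduct, Fintype.sum_sigma, stack]

theorem blockDiagonal'_mulVec_stack (M : ∀ i, Matrix (Fin (m i)) (Fin (n i)) ℝ)
    (x : ∀ i, Fin (n i) → ℝ) :
    Matrix.blockDiagonal' M *ᵥ stack x = stack fun i => M i *ᵥ x i := by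
  ext ⟨i, k⟩
  simp only [Matrix.mulVec, dotProduct, Fintype.sum_sigma, stack]
  rw [Finset.sum_eq_single i]
  · simp only [Matrix.blockDiagonal'_apply_eq]
  · intro j _ hj
    exact Finset.sum_eq_zero fun l _ => by
      rw [Matrix.blockDiagonal'_apply_ne _ _ _ hj.symm, zero_mul]
  · simp

theorem eq_stack (x : (Σ i, Fin (n i)) → ℝ) : x = stack fun i k => x ⟨i, k⟩ := rfl

theorem posSemidef_blockDiagonal' {X : ∀ i, Matrix (Fin (n i)) (Fin (n i)) ℝ}
    (hX : ∀ i, (X i).PosSemidef) : (Matrix.blockDiagonal' X).PosSemidef := by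
  have hX' := fun i => posSemidef_iff_real.1 (hX i)
  refine posSemidef_iff_real.2 ⟨?_, fun x => ?_⟩
  · rw [Matrix.blockDiagonal'_transpose]
    exact congrArg _ (funext fun i => (hX' i).1)
  · rw [eq_stack x, blockDiagonal'_mulVec_stack, stack_dotProduct]
    exact Finset.sum_nonneg fun i _ => (hX' i).2 _

theorem isHurwitz_blockDiagonal' {M : ∀ i, Matrix (Fin (n i)) (Fin (n i)) ℝ}
    (hM : ∀ i, IsHurwitz (M i)) : IsHurwitz (Matrix.blockDiagonal' M) := by
  rw [isHurwitz_iff_real]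
  intro σ ω x y hσ hx hy
  have key := fun i => isHurwitz_iff_real.1 (hM i) σ ω (fun k => x ⟨i, k⟩) (fun k => y ⟨i, k⟩) hσ
    (by
      rw [eq_stack x, blockDiagonal'_mulVec_stack] at hx
      exact funext fun k => congrFun hx ⟨i, k⟩)
    (by
      rw [eq_stack y, blockDiagonal'_mulVec_stack] at hy
      exact funext fun k => congrFun hy ⟨i, k⟩)
  exact ⟨funext fun p => congrFun (key p.1).1 p.2, funext fun p => congrFun (key p.1).2 p.2⟩

end Stack

/-! ### Coercivity of the coupling matrix -/

namespace WeightedDigraph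

variable {N : ℕ} (G : WeightedDigraph N) (iR : Fin N) (d : Fin N → ℝ) {m : Fin N → ℕ}

theorem couplingMatrix_mulVec_stack (v : ∀ i, Fin (m i) → ℝ) (i : Fin N) (k : Fin (m i)) :
    (G.couplingMatrix m iR d *ᵥ stack v) ⟨i, k⟩ =
      (G.pinnedLaplacian iR d *ᵥ fun j => zeroPad (m i) (v j) k) i := by
  simp only [Matrix.mulVec, dotProduct, Fintype.sum_sigma, stack, couplingMatrix, Matrix.of_apply]
  refine Finset.sum_congr rfl fun j _ => ?_
  unfold zeroPad
  split_ifs with h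
  · rw [Finset.sum_eq_single ⟨k.val, h⟩]
    · simp
    · intro l _ hl
      rw [if_neg (fun e => hl (Fin.ext e.symm)), zero_mul]
    · simp
  · rw [mul_zero]
    exact Finset.sum_eq_zero fun l _ => by
      rw [if_neg (fun e => h (by rw [e]; exact l.2)), zero_mul]

theorem stack_fullInfoProtocol (v : ∀ i, Fin (m i) → ℝ) :
    stack (fullInfoProtocol G iR d v) = G.couplingMatrix m iR d *ᵥ stack v := by
  ext ⟨i, k⟩
  rw [couplingMatrix_mulVec_stack, pinnedLaplacian_mulVec]
  simp only [stack, fullInfoProtocol, zeroPad_self, Pi.add_apply, Pi.smul_apply, smul_eq_mul,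
    Finset.sum_apply, Pi.sub_apply]
  split_ifs <;> ring

/-- The form splits over input channels. In channel `k` the nodes with `m i ≤ k` are filled with
zeros, which leaves the form unchanged, so scalar coercivity applies to each channel. -/
theorem stack_dotProduct_couplingMatrix_mulVec
    (hd : ∀ z : Fin N → ℝ, z ⬝ᵥ z ≤ z ⬝ᵥ G.pinnedLaplacian iR d *ᵥ z)
    (v : ∀ i, Fin (m i) → ℝ) :
    stack v ⬝ᵥ stack v ≤ stack v ⬝ᵥ G.couplingMatrix m iR d *ᵥ stack v := by
  let w : ℕ → Fin N → ℝ := fun k j => if h : k < m j then v j ⟨k, h⟩ else 0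
  have hw : ∀ i (k : Fin (m i)), v i k = w k i := fun i k => by simp [w]
  have hsum : ∀ f : ℕ → Fin N → ℝ, ∑ i, ∑ k : Fin (m i), w k i * f k i =
      ∑ k ∈ Finset.range (Finset.univ.sup m), w k ⬝ᵥ f k := by
    intro f
    simp only [dotProduct]
    rw [Finset.sum_comm]
    refine Finset.sum_congr rfl fun i _ => ?_
    rw [Fin.sum_univ_eq_sum_range (fun k => w k i * f k i)]
    refine Finset.sum_subset
      (Finset.range_subset_range.2 (Finset.le_sup (f := m) (Finset.mem_univ i))) fun k _ hk => ?_
    simp only [w]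
    rw [dif_neg (by simpa using hk), zero_mul]
  have h1 : stack v ⬝ᵥ stack v = ∑ k ∈ Finset.range (Finset.univ.sup m), w k ⬝ᵥ w k := by
    rw [← hsum, stack_dotProduct]
    simp only [dotProduct, hw]
  have h2 : stack v ⬝ᵥ G.couplingMatrix m iR d *ᵥ stack v =
      ∑ k ∈ Finset.range (Finset.univ.sup m), w k ⬝ᵥ G.pinnedLaplacian iR d *ᵥ w k := by
    rw [← hsum fun k => G.pinnedLaplacian iR d *ᵥ w k, dotProduct, Fintype.sum_sigma]
    refine Finset.sum_congr rfl fun i _ => Finset.sum_congr rfl fun k _ => ?_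
    rw [couplingMatrix_mulVec_stack]
    exact congrArg (· * _) (hw i k)
  rw [h1, h2]
  exact Finset.sum_le_sum fun k _ => hd _

end WeightedDigraph

/-! ### Closed loop and its stability -/

section ClosedLoop

variable {N : ℕ} {n m : Fin N → ℕ} (G : WeightedDigraph N) (iR : Fin N) (d : Fin N → ℝ)
  (A : ∀ i, Matrix (Fin (n i)) (Fin (n i)) ℝ) (B : ∀ i, Matrix (Fin (n i)) (Fin (m i)) ℝ)

theorem closedLoop_mulVec (F : ∀ i, Matrix (Fin (m i)) (Fin (n i)) ℝ) {n₀ : ℕ}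
    (F₀ : ∀ i, Matrix (Fin (m i)) (Fin n₀) ℝ) (x₀ : Fin n₀ → ℝ) (x : ∀ i, Fin (n i) → ℝ) :
    stack (fun i => A i *ᵥ x i + B i *ᵥ fullInfoProtocol G iR d (fullInfoSignal F₀ F x₀ x) i) =
      closedLoopMatrix G iR d A B F *ᵥ stack x
        + (Matrix.blockDiagonal' B * G.couplingMatrix m iR d) *ᵥ
            stack (fun i => F₀ i *ᵥ x₀) := by
  have h1 : stack (fun i => A i *ᵥ x i +
        B i *ᵥ fullInfoProtocol G iR d (fullInfoSignal F₀ F x₀ x) i) =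
      stack (fun i => A i *ᵥ x i) +
        stack (fun i => B i *ᵥ fullInfoProtocol G iR d (fullInfoSignal F₀ F x₀ x) i) := rfl
  have h2 : stack (fullInfoSignal F₀ F x₀ x) =
      stack (fun i => F₀ i *ᵥ x₀) - stack (fun i => F i *ᵥ x i) := rfl
  rw [h1, ← blockDiagonal'_mulVec_stack A, ← blockDiagonal'_mulVec_stack B,
    G.stack_fullInfoProtocol, h2, ← blockDiagonal'_mulVec_stack F, closedLoopMatrix,
    Matrix.sub_mulVec]
  simp only [← Matrix.mulVec_mulVec, Matrix.mulVec_sub]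
  abel

variable {G iR d A B}

theorem isHurwitz_closedLoopMatrix
    (hd : ∀ z : Fin N → ℝ, z ⬝ᵥ z ≤ z ⬝ᵥ G.pinnedLaplacian iR d *ᵥ z)
    {Q X : ∀ i, Matrix (Fin (n i)) (Fin (n i)) ℝ} (hQ : ∀ i, (Q i).PosSemidef)
    (hX : ∀ i, IsStabilizingSolution (A i) (B i) (Q i) (X i)) :
    IsHurwitz (closedLoopMatrix G iR d A B fun i => (B i)ᵀ * X i) := by
  have hXd := posSemidef_blockDiagonal' fun i => (hX i).posSemidef
  have hXd' := posSemidef_iff_real.1 hXd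
  have hF : (Matrix.blockDiagonal' B)ᵀ * Matrix.blockDiagonal' X =
      Matrix.blockDiagonal' fun i => (B i)ᵀ * X i := by
    rw [Matrix.blockDiagonal'_transpose, Matrix.blockDiagonal'_mul]
  have hM : ∀ x, closedLoopMatrix G iR d A B (fun i => (B i)ᵀ * X i) *ᵥ x =
      Matrix.blockDiagonal' A *ᵥ x - Matrix.blockDiagonal' B *ᵥ (G.couplingMatrix m iR d *ᵥ
        (Matrix.blockDiagonal' (fun i => (B i)ᵀ * X i) *ᵥ x)) := by
    intro x
    rw [closedLoopMatrix, Matrix.sub_mulVec]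
    simp only [← Matrix.mulVec_mulVec]
  have hA : ∀ x, 2 * (x ⬝ᵥ Matrix.blockDiagonal' X *ᵥ (Matrix.blockDiagonal' A *ᵥ x)) ≤
      (Matrix.blockDiagonal' (fun i => (B i)ᵀ * X i) *ᵥ x) ⬝ᵥ
        (Matrix.blockDiagonal' (fun i => (B i)ᵀ * X i) *ᵥ x) := by
    intro x
    rw [eq_stack x]
    simp only [blockDiagonal'_mulVec_stack, stack_dotProduct, Finset.mul_sum]
    refine Finset.sum_le_sum fun i _ => ?_
    have hs := (posSemidef_iff_real.1 (hX i).posSemidef).1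
    have hric : (A i)ᵀ * X i + X i * A i = ((B i)ᵀ * X i)ᵀ * ((B i)ᵀ * X i) - Q i := by
      have h := (hX i).riccati
      rw [Matrix.transpose_mul, Matrix.transpose_transpose, hs, ← Matrix.mul_assoc]
      rw [sub_add, sub_eq_zero] at h
      exact h
    rw [dotProduct_mulVec_lyapunov hs hric, Matrix.sub_mulVec, dotProduct_sub,
      dotProduct_transpose_mul_mulVec]
    linarith [(posSemidef_iff_real.1 (hQ i)).2 fun k => x ⟨i, k⟩]
  -- The drift contributes at most `|F x|²` and the coupling at most `-2 |F x|²`.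
  have hdiss : ∀ x, 2 * (x ⬝ᵥ Matrix.blockDiagonal' X *ᵥ
      (closedLoopMatrix G iR d A B (fun i => (B i)ᵀ * X i) *ᵥ x)) ≤
      -((Matrix.blockDiagonal' (fun i => (B i)ᵀ * X i) *ᵥ x) ⬝ᵥ
        (Matrix.blockDiagonal' (fun i => (B i)ᵀ * X i) *ᵥ x)) := by
    intro x
    rw [hM, Matrix.mulVec_sub, dotProduct_sub,
      dotProduct_mulVec_input hXd'.1 (Matrix.blockDiagonal' B), hF]
    have h1 := hA x
    have h2 := G.stack_dotProduct_couplingMatrix_mulVec iR d hd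
      fun i k => (Matrix.blockDiagonal' (fun i => (B i)ᵀ * X i) *ᵥ x) ⟨i, k⟩
    rw [← eq_stack] at h2
    linarith
  rw [isHurwitz_iff_real]
  intro σ ω x y hσ hx hy
  obtain ⟨h1, h2⟩ := dissipation_eq_zero hXd (fun x => by
    have := hdiss x
    have := dotProduct_self_nonneg_real (Matrix.blockDiagonal' (fun i => (B i)ᵀ * X i) *ᵥ x)
    linarith) hσ hx hy
  -- Zero dissipation gives `F x = 0`, which removes the feedback from both loops and leaves `A x`.
  have key : ∀ x, x ⬝ᵥ Matrix.blockDiagonal' X *ᵥ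
      (closedLoopMatrix G iR d A B (fun i => (B i)ᵀ * X i) *ᵥ x) = 0 →
      closedLoopMatrix G iR d A B (fun i => (B i)ᵀ * X i) *ᵥ x =
        Matrix.blockDiagonal' (fun i => A i - B i * ((B i)ᵀ * X i)) *ᵥ x := by
    intro x h0
    have := hdiss x
    have := dotProduct_self_nonneg_real (Matrix.blockDiagonal' (fun i => (B i)ᵀ * X i) *ᵥ x)
    have hz : Matrix.blockDiagonal' (fun i => (B i)ᵀ * X i) *ᵥ x = 0 :=
      dotProduct_self_eq_zero.1 (by linarith)
    have e : Matrix.blockDiagonal' (fun i => A i - B i * ((B i)ᵀ * X i)) =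
        Matrix.blockDiagonal' A -
          Matrix.blockDiagonal' B * Matrix.blockDiagonal' fun i => (B i)ᵀ * X i := by
      rw [← Matrix.blockDiagonal'_mul, ← Matrix.blockDiagonal'_sub]
      rfl
    rw [hM, e, Matrix.sub_mulVec, ← Matrix.mulVec_mulVec, hz]
    simp only [Matrix.mulVec_zero]
  rw [key x h1] at hx
  rw [key y h2] at hy
  exact isHurwitz_iff_real.1 (isHurwitz_blockDiagonal' fun i => (hX i).hurwitz) σ ω x y hσ hx hy

end ClosedLoop

theorem theorem1 {N : ℕ} (G : WeightedDigraph N) (hG : G.Connected) (n m : Fin N → ℕ)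
    (A : ∀ i, Matrix (Fin (n i)) (Fin (n i)) ℝ) (B : ∀ i, Matrix (Fin (n i)) (Fin (m i)) ℝ)
    (hAB : ∀ i, IsStabilizable (A i) (B i)) :
    (∃ iR, G.IsReachable iR) ∧
    ∀ iR, G.IsReachable iR →
      ∃ d : Fin N → ℝ, (∀ i, 0 < d i) ∧
        ∀ Q : ∀ i, Matrix (Fin (n i)) (Fin (n i)) ℝ, (∀ i, IsAdmissibleWeight (A i) (Q i)) →
          (∀ i, ∃ X, IsStabilizingSolution (A i) (B i) (Q i) X) ∧
          ∀ X : ∀ i, Matrix (Fin (n i)) (Fin (n i)) ℝ,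
            (∀ i, IsStabilizingSolution (A i) (B i) (Q i) (X i)) →
            -- the closed loop under the protocol with gains `F_i = B_i' X_i` is
            -- `x' = (A - B M_D F) x + B M_D r`, where `r_i = F_{0i} x_0`
            (∀ (n₀ : ℕ) (F₀ : ∀ i, Matrix (Fin (m i)) (Fin n₀) ℝ) (x₀ : Fin n₀ → ℝ)
                (x : ∀ i, Fin (n i) → ℝ),
              stack (fun i => A i *ᵥ x i + B i *ᵥ
                  fullInfoProtocol G iR d
                    (fullInfoSignal F₀ (fun i => (B i)ᵀ * X i) x₀ x) i) =
                closedLoopMatrix G iR d A B (fun i => (B i)ᵀ * X i) *ᵥ stack x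
                  + (Matrix.blockDiagonal' B * G.couplingMatrix m iR d) *ᵥ
                      stack (fun i => F₀ i *ᵥ x₀)) ∧
            -- and it is stable
            IsHurwitz (closedLoopMatrix G iR d A B (fun i => (B i)ᵀ * X i)) := by
  refine ⟨hG, fun iR hR => ?_⟩
  obtain ⟨d, hd, hdz⟩ := WeightedDigraph.exists_pos_pinnedLaplacian_coercive hR
  refine ⟨d, hd, fun Q hQ => ⟨fun i => exists_isStabilizingSolution (hAB i) (hQ i), fun X hX =>
    ⟨fun n₀ F₀ x₀ x => closedLoop_mulVec G iR d A B _ F₀ x₀ x,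
      isHurwitz_closedLoopMatrix hdz (fun i => (hQ i).1) hX⟩⟩⟩
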